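/- Hackenbush is played on a finite graph whose edges are coloured blue, red or green and some of whose vertices are on the ground (loops and multiple edges are allowed). Left and Right alternately cut one edge; Left may cut blue or green edges, Right may cut red or green edges, and after each cut everything no longer connected to the ground is removed. Under normal play a player who cannot move loses; under misère play a player who cannot move wins. The outcome of a position is $\mathcal N$ if the player who moves first wins, $\mathcal P$ if the player who moves second wins, $\mathcal L$ if Left wins whoever moves first, and $\mathcal R$ if Right wins whoever moves first; write $o^+(F)$ and $o^-(F)$ for the outcome of $F$ under normal and misère play. A Generalized Flower of height $h\ge 1$ is a green path of length $h$ with one end on the ground and with a red-blue Hackenbush position, its blossom, attached at the other end (the ground of the blossom is identified with that end). Its blossom value is the normal-play value of the blossom, that is, the number obtained recursively as the simplest dyadic rational greater than the values of all left options and less than the values of all right options (simplest: of least denominator and, among integers, of least absolute value). The Generalized Flower is called blue if its blossom value is positive, red if it is negative, and a Stalk if it is zero; in particular a plain green path (with empty blossom) is a Stalk. Let $m\oplus n$ be the nim-sum (bitwise exclusive or) of $m,n\in\mathbb N$ and let $m\Uparrow n:=\max_{0\le n'\le n} m\oplus n'$ be their upper nim-sum. **Proposition 4.7.** Let $F$ be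 the disjoint union (disjunctive sum) of one blue Generalized Flower of height $b_1$, one red Generalized Flower of height $c_1$, and finitely many (possibly no) Stalks whose heights have nim-sum $a$. Suppose $b_1<c_1$. Then $$o^+(F)=o^-(F)=\begin{cases}\mathcal N & \text{if } a\Uparrow(b_1-1)\ge c_1,\\ \mathcal L & \text{if } a\Uparrow(b_1-1)<c_1.\end{cases}$$ -/

import Mathlib

/-! ### Combinatorial games, play conventions, outcomes -/

/-- A combinatorial game `{left options | right options}`, given as a tree. -/
inductive CGame : Type 1
  | mk (L R : Type) (left : L → CGame) (right : R → CGame) : CGame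

/-- Under normal play a player who cannot move loses; under misère play such a player wins. -/
inductive Convention
  | normal
  | misere

inductive Player
  | left
  | right

/-- `G.MoverWins κ p`: player `p`, who is to move in `G`, wins under the convention `κ`.
A player wins moving first if she has no move and play is misère, or if she has a move to a
position that the opponent, moving there, does not win. -/
def CGame.MoverWins (κ : Convention) : CGame → Player → Prop
  | .mk L _ left _, .left =>
      (κ = .misere ∧ IsEmpty L) ∨ ∃ i : L, ¬ (left i).MoverWins κ .right
  | .mk _ R _ right, .right =>
      (κ = .misere ∧ IsEmpty R) ∨ ∃ j : R, ¬ (right j).MoverWins κ .left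

/-- The four outcome classes: next player, previous player, Left, Right. -/
inductive Outcome
  | N
  | P
  | L
  | R

open Classical in
/-- The outcome class of a game under the convention `κ`. -/
noncomputable def CGame.outcome (κ : Convention) (G : CGame) : Outcome :=
  if G.MoverWins κ .left then
    if G.MoverWins κ .right then .N else .L
  else
    if G.MoverWins κ .right then .R else .P

/-! ### Normal-play numerical values -/

/-- `x` is a dyadic rational `a / 2 ^ k`. -/
def IsDyadic (x : ℚ) : Prop := ∃ k : ℕ, x.den = 2 ^ k

/-- `x` is the simplest dyadic rational in the set `s`: its denominator is least possible, and
among the elements of `s` with that denominator (this matters for integers) `|x|` is least. -/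
def IsSimplestIn (s : Set ℚ) (x : ℚ) : Prop :=
  IsDyadic x ∧ x ∈ s ∧
    ∀ y ∈ s, IsDyadic y → x.den < y.den ∨ (x.den = y.den ∧ |x| ≤ |y|)

/-- `G.HasValue x`: the normal-play value of `G` is the number `x`. That is, all options of `G`
have values, and `x` is the simplest dyadic rational that is greater than the values of all left
options and less than the values of all right options. -/
def CGame.HasValue : CGame → ℚ → Prop
  | .mk L R left right, x =>
      ∃ (xl : L → ℚ) (xr : R → ℚ),
        (∀ i, (left i).HasValue (xl i)) ∧ (∀ j, (right j).HasValue (xr j)) ∧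
          IsSimplestIn {y | (∀ i, xl i < y) ∧ ∀ j, y < xr j} x

/-! ### Hackenbush -/

/-- Left may cut blue and green edges, Right may cut red and green edges. -/
inductive EdgeColour
  | blue
  | red
  | green

/-- A Hackenbush picture: a graph (loops and parallel edges allowed) with finitely many coloured
edges, some of whose vertices are on the ground. -/
structure Hackenbush where
  V : Type
  E : Type
  [fintypeE : Fintype E]
  ends : E → Sym2 V
  ground : Set V
  colour : E → EdgeColour

namespace Hackenbush

attribute [instance] Hackenbush.fintypeE

/-- The vertices joined to the ground by a path whose edges lie in `S`. -/
inductive Reachable (G : Hackenbush) (S : Finset G.E) : G.V → Prop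
  | ground (v : G.V) (hv : v ∈ G.ground) : Reachable G S v
  | step (v w : G.V) (e : G.E) (hv : Reachable G S v) (he : e ∈ S) (h : G.ends e = s(v, w)) :
      Reachable G S w

open Classical in
/-- The edges of `S` that are connected to the ground inside `S`. -/
noncomputable def prune (G : Hackenbush) (S : Finset G.E) : Finset G.E :=
  S.filter fun e => ∃ v ∈ G.ends e, G.Reachable S v

open Classical in
/-- Cutting the edge `e` when the edges `S` are present: `e` is removed together with everything
that is then no longer connected to the ground. -/
noncomputable def cut (G : Hackenbush) (S : Finset G.E) (e : G.E) : Finset G.E :=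
  G.prune (S.erase e)

theorem card_cut_lt (G : Hackenbush) {S : Finset G.E} {e : G.E} (he : e ∈ S) :
    (G.cut S e).card < S.card := by
  classical
  refine lt_of_le_of_lt (Finset.card_le_card (Finset.filter_subset _ _)) ?_
  convert Finset.card_erase_lt_of_mem he

/-- The game played from the position in which the edges `S` of `G` are present. -/
noncomputable def gameFrom (G : Hackenbush) (S : Finset G.E) : CGame :=
  .mk {e : G.E // e ∈ S ∧ G.colour e ≠ .red} {e : G.E // e ∈ S ∧ G.colour e ≠ .blue}
    (fun e => G.gameFrom (G.cut S e.1)) (fun e => G.gameFrom (G.cut S e.1))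
termination_by S.card
decreasing_by
  all_goals exact G.card_cut_lt e.2.1

/-- The game of Hackenbush played on the picture `G`. -/
noncomputable def game (G : Hackenbush) : CGame := G.gameFrom (G.prune Finset.univ)

/-- The picture has no green edge. -/
def IsRedBlue (G : Hackenbush) : Prop := ∀ e, G.colour e ≠ .green

/-- The picture with no edges and no vertices. -/
def empty : Hackenbush where
  V := Empty
  E := Empty
  ends := Empty.elim
  ground := ∅
  colour := Empty.elim

/-- The disjunctive sum of Hackenbush positions: the disjoint union of the pictures. -/
def add (G H : Hackenbush) : Hackenbush where
  V := G.V ⊕ H.V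
  E := G.E ⊕ H.E
  ends := Sum.elim (fun e => (G.ends e).map Sum.inl) (fun e => (H.ends e).map Sum.inr)
  ground := Sum.inl '' G.ground ∪ Sum.inr '' H.ground
  colour := Sum.elim G.colour H.colour

/-- The disjunctive sum of a list of Hackenbush positions. -/
def sum : List Hackenbush → Hackenbush
  | [] => empty
  | G :: l => G.add (sum l)

open Classical in
/-- In a picture with stem vertices `0, …, h`, the place of a vertex `v` of the picture `B` that
the stem supports: the ground of `B` becomes the top of the stem. -/
noncomputable def attach (B : Hackenbush) (h : ℕ) (v : B.V) : Fin (h + 1) ⊕ B.V :=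
  if v ∈ B.ground then Sum.inl (Fin.last h) else Sum.inr v

/-- A green path of length `h` (its bottom is the only vertex on the ground) that supports the
picture `B` at its top. -/
noncomputable def onStem (h : ℕ) (B : Hackenbush) : Hackenbush where
  V := Fin (h + 1) ⊕ B.V
  E := Fin h ⊕ B.E
  ends := Sum.elim (fun i => s(Sum.inl i.castSucc, Sum.inl i.succ))
    (fun e => (B.ends e).map (B.attach h))
  ground := {Sum.inl 0}
  colour := Sum.elim (fun _ => .green) B.colour

end Hackenbush

/-! ### Generalized Flowers -/

/-- A Generalized Flower: a green stem of positive height that supports a red-blue Hackenbush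
position, its blossom. -/
structure GeneralizedFlower where
  height : ℕ
  height_pos : 0 < height
  blossom : Hackenbush
  redBlue : blossom.IsRedBlue

namespace GeneralizedFlower

/-- The Hackenbush picture of a Generalized Flower. -/
noncomputable def picture (F : GeneralizedFlower) : Hackenbush :=
  Hackenbush.onStem F.height F.blossom

/-- `F` is blue: its blossom value is positive. -/
def IsBlue (F : GeneralizedFlower) : Prop := ∃ x : ℚ, F.blossom.game.HasValue x ∧ 0 < x

/-- `F` is red: its blossom value is negative. -/
def IsRed (F : GeneralizedFlower) : Prop := ∃ x : ℚ, F.blossom.game.HasValue x ∧ x < 0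

/-- `F` counts as a Stalk: its blossom value is zero. A plain green string is the case of an
empty blossom. -/
def IsStalk (F : GeneralizedFlower) : Prop := F.blossom.game.HasValue 0

end GeneralizedFlower

/-! ### Nim-sums -/

/-- The nim-sum (bitwise exclusive or) of the heights in a list. -/
def nimSum (l : List ℕ) : ℕ := l.foldr (fun m n => m ^^^ n) 0

/-- The upper nim-sum of `m` and `n`: the maximum of `m ⊕ k` over `0 ≤ k ≤ n`. -/
def upperNimSum (m n : ℕ) : ℕ := (Finset.range (n + 1)).sup fun k => m ^^^ k

/-! ### Nim positions under both conventions -/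

/-! Only the height of each component and the sign of its blossom value matter, so a position is
described by a multiset of pairs (height, sign). A move either truncates a stem, leaving a plain
stalk, or changes a blossom, where the sign never moves in the mover's favour and a zero blossom
turns in favour of the opponent. `IsFlowerSum` records these facts, together with the moves that are
always available: truncating a stem to any smaller height, and a blossom move by its owner that does
not hand the blossom to the opponent.

Let the advantage of a player be the number of her flowers minus the number of the opponent's. Four
claims (`Decided`) are proved by simultaneous induction on the number of edges, for both conventions
at once: advantage at least 2 wins moving second; advantage at least 1 wins moving first; stalks
alone play like nim, misère nim included; and a single flower of height b beside stalks of Grundy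
value at least b wins moving second. In the last claim the opponent's only move that does not leave
an advantage of 1 truncates the flower to some k < b, which cannot balance the stalks.

With opposite flowers of heights b < c, the owner of the shorter one, moving first, truncates the
other to some k ≤ b for which the stalks get Grundy value at least b; such k exists by pigeonhole
(`exists_le_grundy_cons`). The owner of the longer flower needs a truncation k < b that makes this
value at least c; after any other truncation of the short flower, the long one is cut to balance the
nim position. Since c ≥ 2, the criterion cannot see the misère correction, so it is the upper
nim-sum condition under both conventions. -/

instance : Std.Commutative (fun m n : ℕ => m ^^^ n) := ⟨Nat.xor_comm⟩
instance : Std.Associative (fun m n : ℕ => m ^^^ n) := ⟨Nat.xor_assoc⟩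

/-- The nim-sum of a multiset of heaps. -/
def xorSum (Q : Multiset ℕ) : ℕ := Q.fold (fun m n => m ^^^ n) 0

@[simp] theorem xorSum_zero : xorSum 0 = 0 := rfl

@[simp] theorem xorSum_cons (k : ℕ) (Q : Multiset ℕ) : xorSum (k ::ₘ Q) = k ^^^ xorSum Q :=
  Multiset.fold_cons_left _ _ _ _

theorem xor_one_le {a : ℕ} (h : a ≤ 1) : a ^^^ 1 ≤ 1 := by
  interval_cases a <;> decide

theorem xorSum_le_one {Q : Multiset ℕ} (h : ∀ k ∈ Q, k ≤ 1) : xorSum Q ≤ 1 := by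
  induction Q using Multiset.induction_on with
  | empty => simp
  | cons k Q ih =>
    rw [xorSum_cons]
    have h1 := ih fun m hm => h m (Multiset.mem_cons_of_mem hm)
    have h2 := h k (Multiset.mem_cons_self k Q)
    generalize xorSum Q = x at *
    interval_cases k <;> interval_cases x <;> decide

/-- From a nim position every smaller nim-sum can be reached. -/
theorem exists_xorSum_eq {Q : Multiset ℕ} {m : ℕ} (h : m < xorSum Q) :
    ∃ k Q', Q = k ::ₘ Q' ∧ ∃ k' < k, xorSum (k' ::ₘ Q') = m := by
  induction Q using Multiset.induction_on generalizing m with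
  | empty => simp at h
  | cons k Q ih =>
    rw [xorSum_cons] at h
    rcases Nat.lt_xor_cases h with h | h
    · exact ⟨k, Q, rfl, _, h, by simp⟩
    · obtain ⟨j, Q', rfl, j', hj, hx⟩ := ih h
      refine ⟨j, k ::ₘ Q', Multiset.cons_swap _ _ _, j', hj, ?_⟩
      rw [Multiset.cons_swap, xorSum_cons, hx, Nat.xor_comm m k, ← Nat.xor_assoc, Nat.xor_self,
        Nat.zero_xor]

/-- No heap of the multiset exceeds `1` and play is misère. -/
def Fickle (κ : Convention) (Q : Multiset ℕ) : Prop := κ = .misere ∧ ∀ k ∈ Q, k ≤ 1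

theorem fickle_cons {κ : Convention} {k : ℕ} {Q : Multiset ℕ} :
    Fickle κ (k ::ₘ Q) ↔ k ≤ 1 ∧ Fickle κ Q := by
  simp only [Fickle, Multiset.forall_mem_cons]
  tauto

theorem Fickle.xorSum_le_one {κ : Convention} {Q : Multiset ℕ} (h : Fickle κ Q) :
    xorSum Q ≤ 1 := _root_.xorSum_le_one h.2

open Classical in
/-- The Grundy value of a nim position under the convention `κ`; it vanishes exactly when the
player who moves second wins. -/
noncomputable def grundy (κ : Convention) (Q : Multiset ℕ) : ℕ :=
  xorSum Q ^^^ if Fickle κ Q then 1 else 0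

theorem grundy_of_fickle {κ : Convention} {Q : Multiset ℕ} (h : Fickle κ Q) :
    grundy κ Q = xorSum Q ^^^ 1 := by rw [grundy, if_pos h]

theorem grundy_of_not_fickle {κ : Convention} {Q : Multiset ℕ} (h : ¬ Fickle κ Q) :
    grundy κ Q = xorSum Q := by rw [grundy, if_neg h, Nat.xor_zero]

theorem Fickle.grundy_le_one {κ : Convention} {Q : Multiset ℕ} (h : Fickle κ Q) :
    grundy κ Q ≤ 1 := by
  rw [grundy_of_fickle h]; exact xor_one_le h.xorSum_le_one

/-- Within one regime this is cancellation of xor. Across regimes a fickle heap k contributes k ^^^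
1 ≤ 1 and a non-fickle heap j contributes j ≥ 2, so they cannot agree. -/
theorem grundy_cons_injective (κ : Convention) (Q : Multiset ℕ) :
    Function.Injective fun k => grundy κ (k ::ₘ Q) := by
  have key : ∀ j k, k ≤ 1 → ¬ j ≤ 1 → Fickle κ Q →
      grundy κ (j ::ₘ Q) ≠ grundy κ (k ::ₘ Q) := by
    intro j k hk hj hQ h
    rw [grundy_of_not_fickle (by simp [fickle_cons, hj]),
      grundy_of_fickle (fickle_cons.2 ⟨hk, hQ⟩), xorSum_cons, xorSum_cons, Nat.xor_right_comm,
      Nat.xor_left_inj] at h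
    exact hj (h ▸ xor_one_le hk)
  intro j k h
  dsimp only at h
  by_cases hQ : Fickle κ Q
  · by_cases hj : j ≤ 1 <;> by_cases hk : k ≤ 1
    · rwa [grundy_of_fickle (fickle_cons.2 ⟨hj, hQ⟩), grundy_of_fickle (fickle_cons.2 ⟨hk, hQ⟩),
        xorSum_cons, xorSum_cons, Nat.xor_left_inj, Nat.xor_left_inj] at h
    · exact absurd h.symm (key k j hj hk hQ)
    · exact absurd h (key j k hk hj hQ)
    · rwa [grundy_of_not_fickle (by simp [fickle_cons, hj]),
        grundy_of_not_fickle (by simp [fickle_cons, hk]), xorSum_cons, xorSum_cons,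
        Nat.xor_left_inj] at h
  · rwa [grundy_of_not_fickle (by simp [fickle_cons, hQ]),
      grundy_of_not_fickle (by simp [fickle_cons, hQ]), xorSum_cons, xorSum_cons,
      Nat.xor_left_inj] at h

/-- A heap as large as the Grundy value balances the position: if `Q` is fickle this heap is at most
1, so adding it does not change the regime. -/
theorem grundy_cons_self (κ : Convention) (Q : Multiset ℕ) :
    grundy κ (grundy κ Q ::ₘ Q) = 0 := by
  by_cases hQ : Fickle κ Q
  · rw [grundy_of_fickle (fickle_cons.2 ⟨hQ.grundy_le_one, hQ⟩), grundy_of_fickle hQ]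
    simp
  · rw [grundy_of_not_fickle (by simp [fickle_cons, hQ]), grundy_of_not_fickle hQ]
    simp

theorem grundy_cons_eq_zero {κ : Convention} {Q : Multiset ℕ} {k : ℕ}
    (h : grundy κ (k ::ₘ Q) = 0) : k = grundy κ Q :=
  grundy_cons_injective κ Q (h.trans (grundy_cons_self κ Q).symm)

/-- Pigeonhole: the b + 1 heights 0, …, b give distinct Grundy values, which cannot all be below b.
-/
theorem exists_le_grundy_cons (κ : Convention) (Q : Multiset ℕ) (b : ℕ) :
    ∃ k ≤ b, b ≤ grundy κ (k ::ₘ Q) := by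
  by_contra! h
  have h1 := Finset.card_le_card_of_injOn (s := Finset.range (b + 1)) (t := Finset.range b)
    (fun k => grundy κ (k ::ₘ Q))
    (fun k hk => by
      simp only [Finset.coe_range, Set.mem_Iio] at hk ⊢
      exact h k (by omega))
    (grundy_cons_injective κ Q).injOn
  simp at h1

/-- Every smaller Grundy value can be reached, except from the end of misère play. -/
theorem exists_grundy_eq {κ : Convention} {Q : Multiset ℕ} {m : ℕ} (h : m < grundy κ Q)
    (h0 : m ≠ 0 ∨ ¬ (κ = .misere ∧ ∀ k ∈ Q, k = 0)) :
    ∃ k Q', Q = k ::ₘ Q' ∧ ∃ k' < k, grundy κ (k' ::ₘ Q') = m := by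
  by_cases hQ : Fickle κ Q
  · have h1 := hQ.grundy_le_one
    have hm : m = 0 := by omega
    have h2 : ∃ k ∈ Q, k ≠ 0 := by
      by_contra! h2
      rcases h0 with h0 | h0
      · exact h0 hm
      · exact h0 ⟨hQ.1, h2⟩
    obtain ⟨k, hk, hk0⟩ := h2
    obtain ⟨Q', rfl⟩ := Multiset.exists_cons_of_mem hk
    obtain ⟨hk1, hQ'⟩ := fickle_cons.1 hQ
    -- The value drops from 1 to 0, and emptying a heap of size 1 flips the parity.
    refine ⟨k, Q', rfl, 0, by omega, ?_⟩
    have hf : Fickle κ (0 ::ₘ Q') := fickle_cons.2 ⟨by omega, hQ'⟩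
    have hk : k = 1 := by omega
    subst hk
    rw [grundy_of_fickle hQ] at h
    have h3 := hf.grundy_le_one
    have h4 := grundy_of_fickle hf
    have h5 := hQ.xorSum_le_one
    have h6 := hQ'.xorSum_le_one
    rw [xorSum_cons] at h h4
    subst hm
    generalize xorSum Q' = x at *
    interval_cases x <;> simp_all
  · rw [grundy_of_not_fickle hQ] at h
    obtain ⟨k, Q', rfl, k', hk', hx⟩ := exists_xorSum_eq h
    by_cases hf : Fickle κ (k' ::ₘ Q')
    · obtain ⟨hk1, hQ'⟩ := fickle_cons.1 hf
      have hk : ¬ k ≤ 1 := fun hk => hQ (fickle_cons.2 ⟨hk, hQ'⟩)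
      have hk2 := xor_one_le hk1
      -- The nim move enters the fickle regime, so the move to the other height in {0, 1}
      -- compensates the misère flip; it is legal because k ≥ 2.
      refine ⟨k, Q', rfl, k' ^^^ 1, by omega, ?_⟩
      rw [grundy_of_fickle (fickle_cons.2 ⟨hk2, hQ'⟩), xorSum_cons, Nat.xor_right_comm,
        Nat.xor_assoc k', Nat.xor_self, Nat.xor_zero, ← xorSum_cons, hx]
    · exact ⟨k, Q', rfl, k', hk', by rw [grundy_of_not_fickle hf, hx]⟩

/-- In the fickle regime both sides are false, as both values are at most 1. This is where the two
conventions become indistinguishable. -/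
theorem le_grundy_cons_iff {κ : Convention} {Q : Multiset ℕ} {k c : ℕ} (hc : 2 ≤ c) :
    c ≤ grundy κ (k ::ₘ Q) ↔ c ≤ xorSum Q ^^^ k := by
  rw [Nat.xor_comm, ← xorSum_cons]
  by_cases hf : Fickle κ (k ::ₘ Q)
  · have h1 := hf.grundy_le_one
    have h2 := hf.xorSum_le_one
    omega
  · rw [grundy_of_not_fickle hf]

theorem le_upperNimSum_iff {κ : Convention} {Q : Multiset ℕ} {b c : ℕ} (hb : 0 < b)
    (hc : 2 ≤ c) :
    c ≤ upperNimSum (xorSum Q) (b - 1) ↔ ∃ k < b, c ≤ grundy κ (k ::ₘ Q) := by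
  rw [upperNimSum, Finset.le_sup_iff (by rw [Nat.bot_eq_zero]; omega), Nat.sub_add_cancel hb]
  simp only [le_grundy_cons_iff hc, Finset.mem_range]

/-! ### Moves and players -/

namespace Player

/-- The opponent of a player. -/
def opp : Player → Player
  | left => right
  | right => left

/-- The sign of the values that favour a player. -/
def sgn : Player → SignType
  | left => 1
  | right => -1

/-- The player may cut edges of the given colour. -/
def CanCut : Player → EdgeColour → Prop
  | left, c => c ≠ .red
  | right, c => c ≠ .blue

@[simp] theorem opp_opp (p : Player) : p.opp.opp = p := by cases p <;> rfl

@[simp] theorem sgn_opp (p : Player) : p.opp.sgn = -p.sgn := by cases p <;> rfl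

@[simp] theorem sgn_mul_sgn (p : Player) : p.sgn * p.sgn = 1 := by cases p <;> rfl

theorem sgn_ne_zero (p : Player) : p.sgn ≠ 0 := by cases p <;> decide

theorem canCut_green (p : Player) : p.CanCut .green := by cases p <;> simp [CanCut]

end Player

namespace Hackenbush

variable {G : Hackenbush} {κ : Convention} {p : Player}

/-- `S'` is the result of a move of the player `p` in the position `S`. -/
def IsOption (G : Hackenbush) (p : Player) (S S' : Finset G.E) : Prop :=
  ∃ e ∈ S, p.CanCut (G.colour e) ∧ S' = G.cut S e

/-- The player `p` wins moving first in the position `S`. -/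
def Wins (G : Hackenbush) (κ : Convention) (p : Player) (S : Finset G.E) : Prop :=
  (G.gameFrom S).MoverWins κ p

theorem IsOption.card_lt {S S' : Finset G.E} (h : G.IsOption p S S') : S'.card < S.card := by
  obtain ⟨e, he, -, rfl⟩ := h
  exact G.card_cut_lt he

theorem wins_iff {S : Finset G.E} :
    G.Wins κ p S ↔ (κ = .misere ∧ ∀ S', ¬ G.IsOption p S S') ∨
      ∃ S', G.IsOption p S S' ∧ ¬ G.Wins κ p.opp S' := by
  rw [Wins, gameFrom]
  cases p
  · simp only [CGame.MoverWins, isEmpty_subtype, IsOption, Wins, Player.CanCut, Player.opp,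
      Subtype.exists]
    constructor
    · rintro (⟨h, h'⟩ | ⟨e, he, h⟩)
      · exact Or.inl ⟨h, fun S' ⟨e, he, hc, _⟩ => h' e ⟨he, hc⟩⟩
      · exact Or.inr ⟨_, ⟨e, he.1, he.2, rfl⟩, h⟩
    · rintro (⟨h, h'⟩ | ⟨S', ⟨e, he, hc, rfl⟩, h⟩)
      · exact Or.inl ⟨h, fun e he => h' _ ⟨e, he.1, he.2, rfl⟩⟩
      · exact Or.inr ⟨e, ⟨he, hc⟩, h⟩
  · simp only [CGame.MoverWins, isEmpty_subtype, IsOption, Wins, Player.CanCut, Player.opp,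
      Subtype.exists]
    constructor
    · rintro (⟨h, h'⟩ | ⟨e, he, h⟩)
      · exact Or.inl ⟨h, fun S' ⟨e, he, hc, _⟩ => h' e ⟨he, hc⟩⟩
      · exact Or.inr ⟨_, ⟨e, he.1, he.2, rfl⟩, h⟩
    · rintro (⟨h, h'⟩ | ⟨S', ⟨e, he, hc, rfl⟩, h⟩)
      · exact Or.inl ⟨h, fun e he => h' _ ⟨e, he.1, he.2, rfl⟩⟩
      · exact Or.inr ⟨e, ⟨he, hc⟩, h⟩

theorem wins_of_option {S S' : Finset G.E} (h : G.IsOption p S S')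
    (h' : ¬ G.Wins κ p.opp S') : G.Wins κ p S :=
  wins_iff.2 (Or.inr ⟨S', h, h'⟩)

/-- An option must exist because a stuck player wins under misère play. -/
theorem not_wins {S : Finset G.E} (h : ∃ S', G.IsOption p S S')
    (h' : ∀ S', G.IsOption p S S' → G.Wins κ p.opp S') : ¬ G.Wins κ p S := by
  rw [wins_iff]
  rintro (⟨-, h0⟩ | ⟨S', h1, h2⟩)
  · exact h.elim h0
  · exact h2 (h' S' h1)

end Hackenbush

/-! ### Sums of Generalized Flowers, seen through heights and signs -/

/-- A possible effect of a move of `p` on the height and on the sign of the blossom value of a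
Generalized Flower: either the stem is cut, or the blossom value moves against `p`. -/
def FlowerMove (p : Player) (c c' : ℕ × SignType) : Prop :=
  (c'.1 < c.1 ∧ c'.2 = 0) ∨
    (c'.1 = c.1 ∧ 0 < c.1 ∧ p.sgn * c'.2 ≤ p.sgn * c.2 ∧
      (c.2 = 0 → c'.2 = -p.sgn))

/-- The number of flowers that favour `p` minus the number of flowers that favour the opponent. -/
def advantage (p : Player) (P : Multiset (ℕ × SignType)) : ℤ :=
  (P.map fun c => ((p.sgn * c.2 : SignType) : ℤ)).sum

@[simp] theorem advantage_cons (p : Player) (c : ℕ × SignType) (P : Multiset (ℕ × SignType)) :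
    advantage p (c ::ₘ P) = ((p.sgn * c.2 : SignType) : ℤ) + advantage p P := by
  simp [advantage]

theorem advantage_eq_zero (p : Player) {P : Multiset (ℕ × SignType)} (h : ∀ c ∈ P, c.2 = 0) :
    advantage p P = 0 := by
  rw [advantage, Multiset.sum_eq_zero]
  simp only [Multiset.mem_map]
  rintro _ ⟨c, hc, rfl⟩
  simp [h c hc]

theorem exists_of_advantage_pos {p : Player} {P : Multiset (ℕ × SignType)}
    (h : 0 < advantage p P) : ∃ b Q, P = (b, p.sgn) ::ₘ Q := by
  induction P using Multiset.induction_on with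
  | empty => simp [advantage] at h
  | cons c P ih =>
    by_cases hc : c.2 = p.sgn
    · exact ⟨c.1, P, by rw [← hc]⟩
    · have h1 : ((p.sgn * c.2 : SignType) : ℤ) ≤ 0 := by
        revert hc
        generalize c.2 = s
        cases p <;> revert s <;> decide
      rw [advantage_cons] at h
      obtain ⟨b, Q, rfl⟩ := ih (by omega)
      exact ⟨b, c ::ₘ Q, Multiset.cons_swap _ _ _⟩

theorem eq_zero_of_advantage_nonpos {p : Player} {P : Multiset (ℕ × SignType)}
    (h : advantage p P ≤ 0) (h' : ∀ c ∈ P, c.2 ≠ -p.sgn) : ∀ c ∈ P, c.2 = 0 := by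
  have key : ∀ s : SignType, s ≠ -p.sgn → 0 ≤ ((p.sgn * s : SignType) : ℤ) ∧
      (((p.sgn * s : SignType) : ℤ) = 0 → s = 0) := by
    cases p <;> decide
  induction P using Multiset.induction_on with
  | empty => simp
  | cons c P ih =>
    rw [Multiset.forall_mem_cons] at h' ⊢
    obtain ⟨h1, h2⟩ := key c.2 h'.1
    rw [advantage_cons] at h
    have h3 : 0 ≤ advantage p P := by
      refine Multiset.sum_nonneg ?_
      simp only [Multiset.mem_map]
      rintro _ ⟨c, hc, rfl⟩
      exact (key c.2 (h'.2 c hc)).1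
    exact ⟨h2 (by omega), ih (by omega) h'.2⟩

/-- Every move of the opponent is good for `p`, unless it cuts the stem of a flower of `p`. -/
theorem FlowerMove.sign_le {p : Player} {c c' : ℕ × SignType} (h : FlowerMove p.opp c c') :
    ((p.sgn * c.2 : SignType) : ℤ) ≤ ((p.sgn * c'.2 : SignType) : ℤ) ∨
      (c.2 = p.sgn ∧ c'.1 < c.1 ∧ c'.2 = 0) := by
  rcases h with ⟨h1, h2⟩ | ⟨-, -, h, -⟩
  · by_cases hc : c.2 = p.sgn
    · exact Or.inr ⟨hc, h1, h2⟩
    · left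
      rw [h2]
      revert hc
      generalize c.2 = s
      cases p <;> revert s <;> decide
  · left
    revert h
    generalize c.2 = s
    generalize c'.2 = s'
    cases p <;> revert s s' <;> decide

/-! ### Deciding positions by advantage and Grundy value. -/

namespace Hackenbush

variable {G : Hackenbush} {κ : Convention} {p : Player}
  {R : Finset G.E → Multiset (ℕ × SignType) → Prop}

/-- The relation `R` describes positions of `G` as sums of Generalized Flowers, given by their
heights and by the signs of their blossom values. -/
structure IsFlowerSum (G : Hackenbush) (R : Finset G.E → Multiset (ℕ × SignType) → Prop) :
    Prop where
  prune_eq : ∀ {S P}, R S P → G.prune S = S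
  pos : ∀ {S P}, R S P → ∀ c ∈ P, c.2 ≠ 0 → 0 < c.1
  move : ∀ {p : Player} {S P S'}, R S P → G.IsOption p S S' →
    ∃ c c' Q, P = c ::ₘ Q ∧ FlowerMove p c c' ∧ R S' (c' ::ₘ Q)
  cutStem : ∀ {S c Q} (p : Player) (k : ℕ), R S (c ::ₘ Q) → k < c.1 →
    ∃ S', G.IsOption p S S' ∧ R S' ((k, 0) ::ₘ Q)
  pluck : ∀ {p : Player} {S b Q}, R S ((b, p.sgn) ::ₘ Q) →
    ∃ S', G.IsOption p S S' ∧ (R S' ((b, 0) ::ₘ Q) ∨ R S' ((b, p.sgn) ::ₘ Q))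

/-- What the advantage and the Grundy value of the heights tell about the winner. -/
structure Decided (G : Hackenbush) (κ : Convention) (S : Finset G.E)
    (P : Multiset (ℕ × SignType)) : Prop where
  two_le : ∀ p : Player, 2 ≤ advantage p P → ¬ G.Wins κ p.opp S
  one_le : ∀ p : Player, 1 ≤ advantage p P → G.Wins κ p S
  stalks : ∀ p : Player, (∀ c ∈ P, c.2 = 0) → (G.Wins κ p S ↔ grundy κ (P.map Prod.fst) ≠ 0)
  flower : ∀ (p : Player) b Q, P = (b, p.sgn) ::ₘ Q → (∀ c ∈ Q, c.2 = 0) →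
    b ≤ grundy κ (Q.map Prod.fst) → ¬ G.Wins κ p.opp S

/-- One move of the opponent costs `p` at most one flower, so an advantage of 1 remains with `p` to
move. The opponent is never stuck, because a flower has a green edge. -/
theorem IsFlowerSum.not_wins_of_two_le (hR : G.IsFlowerSum R) {S : Finset G.E}
    {P : Multiset (ℕ × SignType)} (hS : R S P)
    (ih : ∀ S' P', S'.card < S.card → R S' P' → G.Decided κ S' P')
    (h : 2 ≤ advantage p P) : ¬ G.Wins κ p.opp S := by
  refine not_wins ?_ fun S' hS' => ?_
  · obtain ⟨b, Q, rfl⟩ := exists_of_advantage_pos (by omega : 0 < advantage p P)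
    have hb := hR.pos hS (b, p.sgn) (Multiset.mem_cons_self _ _) p.sgn_ne_zero
    obtain ⟨S', h1, -⟩ := hR.cutStem p.opp 0 hS hb
    exact ⟨S', h1⟩
  · obtain ⟨c, c', Q, rfl, hc, hR'⟩ := hR.move hS hS'
    rw [Player.opp_opp]
    refine (ih _ _ hS'.card_lt hR').one_le p ?_
    rw [advantage_cons] at h ⊢
    rcases hc.sign_le with h1 | ⟨h1, -, h2⟩
    · omega
    · rw [h1, Player.sgn_mul_sgn] at h
      rw [h2]
      simp only [SignType.coe_one, mul_zero, SignType.coe_zero] at h ⊢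
      omega

/-- A flower of the opponent is cut down, raising the advantage to 2. If there is none, the strategy
depends on whether `p` has at least three flowers, two, or one. -/
theorem IsFlowerSum.wins_of_one_le (hR : G.IsFlowerSum R) {S : Finset G.E}
    {P : Multiset (ℕ × SignType)} (hS : R S P)
    (ih : ∀ S' P', S'.card < S.card → R S' P' → G.Decided κ S' P')
    (h : 1 ≤ advantage p P) : G.Wins κ p S := by
  have hone : ((p.sgn * p.sgn : SignType) : ℤ) = 1 := by simp
  by_cases hneg : ∃ c ∈ P, c.2 = -p.sgn
  · obtain ⟨c, hc, hs⟩ := hneg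
    obtain ⟨Q, rfl⟩ := Multiset.exists_cons_of_mem hc
    have hpos := hR.pos hS c hc (by rw [hs]; cases p <;> decide)
    obtain ⟨S', h1, h2⟩ := hR.cutStem p 0 hS hpos
    refine wins_of_option h1 ((ih _ _ h1.card_lt h2).two_le p ?_)
    have : ((p.sgn * -p.sgn : SignType) : ℤ) = -1 := by cases p <;> rfl
    rw [advantage_cons, hs, this] at h
    simp only [advantage_cons, mul_zero, SignType.coe_zero]
    omega
  push Not at hneg
  -- Move in a flower `b` so that the rest `Q` beats a flower `d`.
  obtain ⟨b, Q, rfl⟩ := exists_of_advantage_pos (by omega : 0 < advantage p P)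
  rw [advantage_cons, hone] at h
  have hb := hR.pos hS (b, p.sgn) (Multiset.mem_cons_self _ _) p.sgn_ne_zero
  have hneg' := fun c hc => hneg c (Multiset.mem_cons_of_mem hc)
  by_cases hQ : 1 ≤ advantage p Q
  · obtain ⟨d, Q, rfl⟩ := exists_of_advantage_pos (by omega : 0 < advantage p Q)
    rw [advantage_cons, hone] at hQ
    by_cases hQ2 : 1 ≤ advantage p Q
    · obtain ⟨S', h1, h2⟩ := hR.cutStem p 0 hS hb
      refine wins_of_option h1 ((ih _ _ h1.card_lt h2).two_le p ?_)
      simp only [advantage_cons, mul_zero, SignType.coe_zero, hone]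
      omega
    · have hz := eq_zero_of_advantage_nonpos (by omega : advantage p Q ≤ 0)
        fun c hc => hneg' c (Multiset.mem_cons_of_mem hc)
      clear h hneg hneg'
      -- The taller flower is spent and the shorter one kept, so a Grundy value of at least b
      -- suffices for d.
      wlog hdb : d ≤ b generalizing b d
      · refine this d ?_ b ?_ (by omega)
        · exact hR.pos hS (d, p.sgn) (by simp) p.sgn_ne_zero
        · rwa [Multiset.cons_swap]
      obtain ⟨k, hk, hg⟩ := exists_le_grundy_cons κ (Q.map Prod.fst) b
      have hwin : ∀ S', G.IsOption p S S' → R S' ((k, 0) ::ₘ (d, p.sgn) ::ₘ Q) →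
          G.Wins κ p S := by
        intro S' h1 h2
        refine wins_of_option h1 ((ih _ _ h1.card_lt h2).flower p d ((k, 0) ::ₘ Q)
          (Multiset.cons_swap _ _ _) ?_ ?_)
        · simpa [Multiset.forall_mem_cons] using hz
        · rw [Multiset.map_cons]; exact hdb.trans hg
      rcases hk.lt_or_eq with hk | rfl
      · obtain ⟨S', h1, h2⟩ := hR.cutStem p k hS hk
        exact hwin S' h1 h2
      -- Height b itself is not reached by truncation, but by playing in the blossom; if its sign
      -- survives, the advantage is still 2.
      · obtain ⟨S', h1, h2 | h2⟩ := hR.pluck hS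
        · exact hwin S' h1 h2
        · refine wins_of_option h1 ((ih _ _ h1.card_lt h2).two_le p ?_)
          simp only [advantage_cons, hone]
          omega
  · have hz := eq_zero_of_advantage_nonpos (by omega : advantage p Q ≤ 0) hneg'
    have hnim : ∀ S', G.IsOption p S S' → R S' ((grundy κ (Q.map Prod.fst), 0) ::ₘ Q) →
        G.Wins κ p S := by
      intro S' h1 h2
      refine wins_of_option h1 ?_
      rw [(ih _ _ h1.card_lt h2).stalks p.opp (by simpa [Multiset.forall_mem_cons] using hz)]
      simp [grundy_cons_self]
    -- With one flower: if the stalks have value below b, truncate the flower to balance them; if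
    -- equal to b, play in the blossom; if above b, lower the stalks to value exactly b.
    rcases lt_trichotomy (grundy κ (Q.map Prod.fst)) b with hlt | heq | hgt
    · obtain ⟨S', h1, h2⟩ := hR.cutStem p _ hS hlt
      exact hnim S' h1 h2
    · obtain ⟨S', h1, h2 | h2⟩ := hR.pluck hS
      · exact hnim S' h1 (by rwa [heq])
      · exact wins_of_option h1
          ((ih _ _ h1.card_lt h2).flower p b Q rfl hz heq.ge)
    · obtain ⟨j, Q₁, hQ₁, j', hj, hg⟩ := exists_grundy_eq hgt (Or.inl (by simp at hb; omega))
      obtain ⟨c, hc, rfl⟩ := Multiset.mem_map.1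
        (hQ₁ ▸ Multiset.mem_cons_self j Q₁ : j ∈ Q.map Prod.fst)
      obtain ⟨Q₂, rfl⟩ := Multiset.exists_cons_of_mem hc
      rw [Multiset.map_cons, Multiset.cons_inj_right] at hQ₁
      subst hQ₁
      rw [Multiset.cons_swap] at hS
      obtain ⟨S', h1, h2⟩ := hR.cutStem p j' hS hj
      refine wins_of_option h1 ((ih _ _ h1.card_lt h2).flower p b ((j', 0) ::ₘ Q₂)
          (Multiset.cons_swap _ _ _) ?_ ?_)
      · rw [Multiset.forall_mem_cons] at hz ⊢
        exact ⟨rfl, hz.2⟩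
      · rw [Multiset.map_cons, hg]

/-- Stem cuts are nim moves, and a move in a zero blossom loses because it gives the opponent a
flower and the turn. -/
theorem IsFlowerSum.wins_stalks_iff (hR : G.IsFlowerSum R) {S : Finset G.E}
    {P : Multiset (ℕ × SignType)} (hS : R S P)
    (ih : ∀ S' P', S'.card < S.card → R S' P' → G.Decided κ S' P')
    (h : ∀ c ∈ P, c.2 = 0) : G.Wins κ p S ↔ grundy κ (P.map Prod.fst) ≠ 0 := by
  -- The end of misère play is separate: the mover is stuck and wins, matching Grundy value 1.
  by_cases hend : κ = .misere ∧ ∀ k ∈ P.map Prod.fst, k = 0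
  · refine iff_of_true (wins_iff.2 (Or.inl ⟨hend.1, fun S' hS' => ?_⟩)) ?_
    · obtain ⟨c, c', Q, rfl, hc, -⟩ := hR.move hS hS'
      have : c.1 = 0 := hend.2 _ (by simp)
      rcases hc with hc | hc <;> omega
    · have hf : Fickle κ (P.map Prod.fst) := ⟨hend.1, fun k hk => by rw [hend.2 k hk]; omega⟩
      have h0 : xorSum (P.map Prod.fst) = 0 := by
        have h0 := hend.2
        generalize P.map Prod.fst = Q at h0
        induction Q using Multiset.induction_on with
        | empty => rfl
        | cons k Q ihQ =>
          rw [Multiset.forall_mem_cons] at h0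
          rw [xorSum_cons, h0.1, ihQ h0.2]; rfl
      rw [grundy_of_fickle hf, h0]; decide
  · constructor
    · intro hw h0
      rcases wins_iff.1 hw with ⟨rfl, hno⟩ | ⟨S', h1, h2⟩
      · refine hend ⟨rfl, fun k hk => ?_⟩
        obtain ⟨c, hc, rfl⟩ := Multiset.mem_map.1 hk
        obtain ⟨Q, rfl⟩ := Multiset.exists_cons_of_mem hc
        by_contra hc0
        obtain ⟨S', h1, -⟩ := hR.cutStem p 0 hS (by omega)
        exact hno S' h1
      · obtain ⟨c, c', Q, rfl, hc, hR'⟩ := hR.move hS h1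
        have ih' := ih _ _ h1.card_lt hR'
        rw [Multiset.forall_mem_cons] at h
        refine h2 ?_
        rcases hc with ⟨hlt, hc'⟩ | ⟨-, -, -, hc'⟩
        · rw [ih'.stalks p.opp (by rw [Multiset.forall_mem_cons]; exact ⟨hc', h.2⟩)]
          rw [Multiset.map_cons] at h0 ⊢
          intro h3
          have := grundy_cons_injective κ (Q.map Prod.fst) (h3.trans h0.symm)
          omega
        · refine ih'.one_le p.opp ?_
          have : ((p.opp.sgn * -p.sgn : SignType) : ℤ) = 1 := by cases p <;> rfl
          rw [advantage_cons, hc' h.1, this, advantage_eq_zero _ h.2]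
          rfl
    · intro h0
      obtain ⟨j, Q₁, hQ₁, j', hj, hg⟩ := exists_grundy_eq (Nat.pos_of_ne_zero h0) (Or.inr hend)
      obtain ⟨c, hc, rfl⟩ := Multiset.mem_map.1
        (hQ₁ ▸ Multiset.mem_cons_self j Q₁ : j ∈ P.map Prod.fst)
      obtain ⟨Q₂, rfl⟩ := Multiset.exists_cons_of_mem hc
      rw [Multiset.map_cons, Multiset.cons_inj_right] at hQ₁
      subst hQ₁
      obtain ⟨S', h1, h2⟩ := hR.cutStem p j' hS hj
      refine wins_of_option h1 ?_
      rw [Multiset.forall_mem_cons] at h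
      rw [(ih _ _ h1.card_lt h2).stalks p.opp
        (by rw [Multiset.forall_mem_cons]; exact ⟨rfl, h.2⟩), Multiset.map_cons, hg]
      simp

/-- Truncating the flower to k < b cannot produce Grundy value 0, since only the height `grundy κ
(Q.map Prod.fst)`, which is at least b, does so. Every other move leaves `p` with advantage at least
1. -/
theorem IsFlowerSum.not_wins_flower (hR : G.IsFlowerSum R) {S : Finset G.E} {b : ℕ}
    {Q : Multiset (ℕ × SignType)} (hS : R S ((b, p.sgn) ::ₘ Q))
    (ih : ∀ S' P', S'.card < S.card → R S' P' → G.Decided κ S' P')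
    (h : ∀ c ∈ Q, c.2 = 0) (hb : b ≤ grundy κ (Q.map Prod.fst)) : ¬ G.Wins κ p.opp S := by
  refine not_wins ?_ fun S' hS' => ?_
  · obtain ⟨S', h1, -⟩ := hR.cutStem p.opp 0 hS
      (hR.pos hS (b, p.sgn) (Multiset.mem_cons_self _ _) p.sgn_ne_zero)
    exact ⟨S', h1⟩
  · obtain ⟨c, c', Q', hQ, hc, hR'⟩ := hR.move hS hS'
    have ih' := ih _ _ hS'.card_lt hR'
    rw [Player.opp_opp]
    rcases hc.sign_le with h1 | ⟨h1, h2, h3⟩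
    · refine ih'.one_le p ?_
      have h4 : advantage p ((b, p.sgn) ::ₘ Q) = 1 := by
        rw [advantage_cons, advantage_eq_zero p h]; simp
      rw [hQ, advantage_cons] at h4
      rw [advantage_cons]
      omega
    · have hcQ : c ∈ (b, p.sgn) ::ₘ Q := hQ ▸ Multiset.mem_cons_self _ _
      rcases Multiset.mem_cons.1 hcQ with rfl | hcQ
      · rw [Multiset.cons_inj_right] at hQ
        subst hQ
        rw [ih'.stalks p (by rw [Multiset.forall_mem_cons]; exact ⟨h3, h⟩), Multiset.map_cons]
        intro h4
        have := grundy_cons_eq_zero h4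
        simp only at h2
        omega
      · exact absurd (h1.symm.trans (h c hcQ)) p.sgn_ne_zero

theorem IsFlowerSum.decided (hR : G.IsFlowerSum R) (κ : Convention) {S : Finset G.E}
    {P : Multiset (ℕ × SignType)} (hS : R S P) : G.Decided κ S P := by
  induction hn : S.card using Nat.strong_induction_on generalizing S P with
  | _ n ih =>
    have ih' : ∀ S' P', S'.card < S.card → R S' P' → G.Decided κ S' P' :=
      fun S' P' hlt hR' => ih _ (hn ▸ hlt) hR' rfl
    exact
      { two_le := fun p h => hR.not_wins_of_two_le hS ih' h
        one_le := fun p h => hR.wins_of_one_le hS ih' h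
        stalks := fun p h => hR.wins_stalks_iff hS ih' h
        flower := fun p b Q hP h hb => hR.not_wins_flower (hP ▸ hS) ih' h hb }

/-! ### Two flowers of opposite signs -/

/-- The owner of the shorter flower wins moving first. -/
theorem IsFlowerSum.wins_of_lt (hR : G.IsFlowerSum R) {S : Finset G.E} {b c : ℕ}
    {Q : Multiset (ℕ × SignType)} (hS : R S ((b, p.sgn) ::ₘ (c, -p.sgn) ::ₘ Q))
    (h : ∀ c ∈ Q, c.2 = 0) (hbc : b < c) : G.Wins κ p S := by
  -- As k ≤ b < c, the longer flower can be truncated to k, which lifts the stalks to value at least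
  -- b.
  obtain ⟨k, hk, hg⟩ := exists_le_grundy_cons κ (Q.map Prod.fst) b
  rw [Multiset.cons_swap] at hS
  obtain ⟨S', h1, h2⟩ := hR.cutStem p k hS (by simp only; omega)
  refine wins_of_option h1 ((hR.decided κ h2).flower p b ((k, 0) ::ₘ Q)
    (Multiset.cons_swap _ _ _) ?_ ?_)
  · rw [Multiset.forall_mem_cons]; exact ⟨rfl, h⟩
  · rwa [Multiset.map_cons]

/-- The owner of the longer flower wins moving first if and only if cutting the shorter flower
can raise the Grundy value of the stalks to the height of the longer one. -/
theorem IsFlowerSum.opp_wins_iff (hR : G.IsFlowerSum R) {S : Finset G.E} {b c : ℕ}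
    {Q : Multiset (ℕ × SignType)} (hS : R S ((b, p.sgn) ::ₘ (c, -p.sgn) ::ₘ Q))
    (h : ∀ c ∈ Q, c.2 = 0) (hbc : b < c) :
    G.Wins κ p.opp S ↔ ∃ k < b, c ≤ grundy κ (k ::ₘ Q.map Prod.fst) := by
  constructor
  · intro hw
    by_contra! hlt
    refine not_wins ?_ (fun S' hS' => ?_) hw
    · obtain ⟨S', h1, -⟩ := hR.cutStem p.opp 0 hS
        (hR.pos hS (b, p.sgn) (Multiset.mem_cons_self _ _) p.sgn_ne_zero)
      exact ⟨S', h1⟩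
    rw [Player.opp_opp]
    obtain ⟨x, x', Q', hQ, hx, hR'⟩ := hR.move hS hS'
    have hd := hR.decided κ hR'
    have hadv : advantage p ((b, p.sgn) ::ₘ (c, -p.sgn) ::ₘ Q) = 0 := by
      rw [advantage_cons, advantage_cons, advantage_eq_zero p h]
      cases p <;> rfl
    have hmem : x ∈ (b, p.sgn) ::ₘ (c, -p.sgn) ::ₘ Q := hQ ▸ Multiset.mem_cons_self _ _
    rw [hQ, advantage_cons] at hadv
    by_cases hgain : 1 ≤ advantage p (x' ::ₘ Q')
    · exact hd.one_le p hgain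
    rw [advantage_cons] at hgain
    rcases Multiset.mem_cons.1 hmem with rfl | hmem
    · rw [Multiset.cons_inj_right] at hQ
      subst hQ
      rcases hx with ⟨h1, h2⟩ | ⟨h1, -, h2, -⟩
      · simp only at h1
        obtain ⟨k, z⟩ := x'
        simp only at h1 h2
        subst h2
        have h3 := hlt k h1
        set g := grundy κ (k ::ₘ Q.map Prod.fst) with hg
        rw [Multiset.cons_swap] at hR'
        -- The reply cuts the long flower to the height g < c that balances the remaining stalks.
        obtain ⟨S₂, h4, h5⟩ := hR.cutStem p g hR' h3
        refine wins_of_option h4 ?_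
        rw [(hR.decided κ h5).stalks p.opp (by simpa [Multiset.forall_mem_cons] using h),
          Multiset.map_cons, Multiset.map_cons]
        simp only [hg, grundy_cons_self, ne_eq, not_true_eq_false, not_false_eq_true]
      · obtain ⟨b', z⟩ := x'
        obtain rfl : b' = b := h1
        -- The sign `p.sgn` is already the worst possible for the mover, so her move in this blossom
        -- cannot change it.
        have key : ∀ s : SignType, p.opp.sgn * s ≤ p.opp.sgn * p.sgn → s = p.sgn := by
          cases p <;> decide
        have hz := key z h2
        subst hz
        exact hR.wins_of_lt hR' h hbc
    rw [← Multiset.cons_erase hmem, Multiset.cons_swap, Multiset.cons_inj_right] at hQ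
    subst hQ
    rcases Multiset.mem_cons.1 hmem with rfl | hmemQ
    · rw [Multiset.erase_cons_head] at *
      rcases hx with ⟨h1, h2⟩ | ⟨h1, -, h2, -⟩
      · exfalso
        rw [h2] at hgain
        have : ((p.sgn * -p.sgn : SignType) : ℤ) = -1 := by cases p <;> rfl
        simp only [this] at hadv
        simp only [mul_zero, SignType.coe_zero] at hgain
        omega
      · obtain ⟨c', z⟩ := x'
        obtain rfl : c' = c := h1
        by_cases hz : z = -p.sgn
        · subst hz
          rw [Multiset.cons_swap] at hR'
          exact hR.wins_of_lt hR' h hbc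
        · exfalso
          have key : ∀ s : SignType, s ≠ -p.sgn →
              ((p.sgn * -p.sgn : SignType) : ℤ) < ((p.sgn * s : SignType) : ℤ) := by
            cases p <;> decide
          have h3 := key z hz
          simp only at hadv hgain
          omega
    · have hx0 := h x hmemQ
      rw [hx0] at hadv
      simp only [mul_zero, SignType.coe_zero] at hadv
      rcases hx with ⟨h1, h2⟩ | ⟨-, -, -, h2⟩
      -- Truncating a stalk leaves both flowers untouched, so the owner of the shorter one still
      -- wins moving first.
      · have hne : (c, -p.sgn) ≠ x := by
          rintro rfl
          revert hx0
          simp [p.sgn_ne_zero]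
        rw [Multiset.erase_cons_tail _ hne] at hR'
        refine hR.wins_of_lt (Q := x' ::ₘ Q.erase x) ?_ ?_ hbc
        · rwa [Multiset.cons_swap (c, -p.sgn), Multiset.cons_swap (b, p.sgn)]
        · rw [Multiset.forall_mem_cons]
          exact ⟨h2, fun y hy => h y (Multiset.mem_of_mem_erase hy)⟩
      · exfalso
        have h3 : ((p.sgn * x'.2 : SignType) : ℤ) = 1 := by
          rw [h2 hx0]; cases p <;> rfl
        omega
  · rintro ⟨k, hk, hg⟩
    obtain ⟨S', h1, h2⟩ := hR.cutStem p.opp k hS hk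
    refine wins_of_option h1 ((hR.decided κ h2).flower p.opp c ((k, 0) ::ₘ Q)
      (by rw [Multiset.cons_swap, Player.sgn_opp]) ?_ (by rwa [Multiset.map_cons]))
    rw [Multiset.forall_mem_cons]; exact ⟨rfl, h⟩

end Hackenbush

namespace Hackenbush

/-! ### Pruning -/

section Prune

variable {G : Hackenbush}

theorem mem_prune {S : Finset G.E} {e : G.E} :
    e ∈ G.prune S ↔ e ∈ S ∧ ∃ v ∈ G.ends e, G.Reachable S v := by
  simp [prune]

theorem reachable_prune {S : Finset G.E} {v : G.V} :
    G.Reachable (G.prune S) v ↔ G.Reachable S v := by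
  constructor <;> intro h
  · induction h with
    | ground v hv => exact .ground v hv
    | step v w e _ he h ih => exact .step v w e ih (mem_prune.1 he).1 h
  · induction h with
    | ground v hv => exact .ground v hv
    | step v w e hv he h ih =>
      exact .step v w e ih (mem_prune.2 ⟨he, v, by simp [h], hv⟩) h

theorem prune_prune (S : Finset G.E) : G.prune (G.prune S) = G.prune S := by
  ext e
  rw [mem_prune, and_iff_left_iff_imp]
  intro he
  obtain ⟨-, v, hv, hr⟩ := mem_prune.1 he
  exact ⟨v, hv, reachable_prune.2 hr⟩

theorem prune_cut (S : Finset G.E) (e : G.E) : G.prune (G.cut S e) = G.cut S e :=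
  prune_prune _

theorem IsOption.prune_eq {p : Player} {S S' : Finset G.E} (h : G.IsOption p S S') :
    G.prune S' = S' := by
  obtain ⟨e, -, -, rfl⟩ := h
  exact prune_cut S e

end Prune

/-! ### Disjoint unions -/

section Add

variable {G H : Hackenbush}

/-- The edges of the first summand, as edges of the disjoint union. -/
def inlE (H : Hackenbush) (e : G.E) : (G.add H).E := (Sum.inl e : G.E ⊕ H.E)

/-- The edges of the second summand, as edges of the disjoint union. -/
def inrE (G : Hackenbush) (e : H.E) : (G.add H).E := (Sum.inr e : G.E ⊕ H.E)

/-- The vertices of the first summand, as vertices of the disjoint union. -/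
def inlV (H : Hackenbush) (v : G.V) : (G.add H).V := (Sum.inl v : G.V ⊕ H.V)

/-- The vertices of the second summand, as vertices of the disjoint union. -/
def inrV (G : Hackenbush) (v : H.V) : (G.add H).V := (Sum.inr v : G.V ⊕ H.V)

theorem inlE_injective : Function.Injective (inlE H : G.E → (G.add H).E) := Sum.inl_injective

theorem inrE_injective : Function.Injective (inrE G : H.E → (G.add H).E) := Sum.inr_injective

theorem inlE_ne_inrE (e : G.E) (d : H.E) : inlE H e ≠ inrE G d := Sum.inl_ne_inr

theorem addE_cases {motive : (G.add H).E → Prop} (inl : ∀ e, motive (inlE H e))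
    (inr : ∀ e, motive (inrE G e)) (e : (G.add H).E) : motive e :=
  Sum.rec (motive := motive) inl inr e

/-- The edges of the first summand. -/
def leftPart (S : Finset (G.add H).E) : Finset G.E := Finset.toLeft (α := G.E) (β := H.E) S

/-- The edges of the second summand. -/
def rightPart (S : Finset (G.add H).E) : Finset H.E := Finset.toRight (α := G.E) (β := H.E) S

theorem mem_leftPart {S : Finset (G.add H).E} {e : G.E} : e ∈ leftPart S ↔ inlE H e ∈ S :=
  Finset.mem_toLeft

theorem mem_rightPart {S : Finset (G.add H).E} {e : H.E} : e ∈ rightPart S ↔ inrE G e ∈ S :=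
  Finset.mem_toRight

theorem ends_inlE (e : G.E) : (G.add H).ends (inlE H e) = (G.ends e).map (inlV H) := rfl

theorem ends_inrE (e : H.E) : (G.add H).ends (inrE G e) = (H.ends e).map (inrV G) := rfl

/-- Both summands are treated together through `Sum.elim` so that induction along a path in the
union applies. -/
theorem Reachable.of_add {S : Finset (G.add H).E} {v : (G.add H).V}
    (h : (G.add H).Reachable S v) :
    Sum.elim (G.Reachable (leftPart S)) (H.Reachable (rightPart S)) v := by
  induction h with
  | ground v hv =>
    rcases hv with ⟨u, hu, rfl⟩ | ⟨u, hu, rfl⟩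
    · exact Reachable.ground u hu
    · exact Reachable.ground u hu
  | step v w e _ he h ih =>
    induction e using addE_cases with
    | inl e =>
      rw [ends_inlE] at h
      revert h
      generalize hab : G.ends e = z
      induction z using Sym2.ind with | _ a b
      rw [Sym2.map_mk, Sym2.eq_iff]
      rintro (⟨rfl, rfl⟩ | ⟨rfl, rfl⟩)
      · exact Reachable.step a b e ih (mem_leftPart.2 he) hab
      · exact Reachable.step b a e ih (mem_leftPart.2 he) (hab.trans Sym2.eq_swap)
    | inr e =>
      rw [ends_inrE] at h
      revert h
      generalize hab : H.ends e = z
      induction z using Sym2.ind with | _ a b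
      rw [Sym2.map_mk, Sym2.eq_iff]
      rintro (⟨rfl, rfl⟩ | ⟨rfl, rfl⟩)
      · exact Reachable.step a b e ih (mem_rightPart.2 he) hab
      · exact Reachable.step b a e ih (mem_rightPart.2 he) (hab.trans Sym2.eq_swap)

theorem reachable_inlV {S : Finset (G.add H).E} {v : G.V} :
    (G.add H).Reachable S (inlV H v) ↔ G.Reachable (leftPart S) v := by
  refine ⟨fun h => h.of_add, fun h => ?_⟩
  induction h with
  | ground v hv => exact .ground _ (Or.inl ⟨v, hv, rfl⟩)
  | step v w e _ he h ih =>
    exact .step _ _ _ ih (mem_leftPart.1 he) (by rw [ends_inlE, h, Sym2.map_mk])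

theorem reachable_inrV {S : Finset (G.add H).E} {v : H.V} :
    (G.add H).Reachable S (inrV G v) ↔ H.Reachable (rightPart S) v := by
  refine ⟨fun h => h.of_add, fun h => ?_⟩
  induction h with
  | ground v hv => exact .ground _ (Or.inr ⟨v, hv, rfl⟩)
  | step v w e _ he h ih =>
    exact .step _ _ _ ih (mem_rightPart.1 he) (by rw [ends_inrE, h, Sym2.map_mk])

theorem leftPart_prune (S : Finset (G.add H).E) :
    leftPart ((G.add H).prune S) = G.prune (leftPart S) := by
  ext e
  rw [mem_leftPart, mem_prune, mem_prune, mem_leftPart, ends_inlE]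
  simp only [Sym2.mem_map, exists_exists_and_eq_and, reachable_inlV]

theorem rightPart_prune (S : Finset (G.add H).E) :
    rightPart ((G.add H).prune S) = H.prune (rightPart S) := by
  ext e
  rw [mem_rightPart, mem_prune, mem_prune, mem_rightPart, ends_inrE]
  simp only [Sym2.mem_map, exists_exists_and_eq_and, reachable_inrV]

theorem eq_of_parts {S T : Finset (G.add H).E} (h : leftPart S = leftPart T)
    (h' : rightPart S = rightPart T) : S = T := by
  ext e
  induction e using addE_cases with
  | inl e => rw [← mem_leftPart, h, mem_leftPart]
  | inr e => rw [← mem_rightPart, h', mem_rightPart]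

theorem leftPart_cut_inl (S : Finset (G.add H).E) (e : G.E) :
    leftPart ((G.add H).cut S (inlE H e)) = G.cut (leftPart S) e := by
  classical
  rw [cut, leftPart_prune, cut]
  congr 1
  ext d
  rw [mem_leftPart, Finset.mem_erase, Finset.mem_erase, mem_leftPart]
  exact and_congr_left' (not_congr inlE_injective.eq_iff)

theorem rightPart_cut_inl (S : Finset (G.add H).E) (e : G.E) :
    rightPart ((G.add H).cut S (inlE H e)) = H.prune (rightPart S) := by
  classical
  rw [cut, rightPart_prune]
  congr 1
  ext d
  rw [mem_rightPart, Finset.mem_erase, mem_rightPart]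
  exact and_iff_right (inlE_ne_inrE _ _).symm

theorem leftPart_cut_inr (S : Finset (G.add H).E) (e : H.E) :
    leftPart ((G.add H).cut S (inrE G e)) = G.prune (leftPart S) := by
  classical
  rw [cut, leftPart_prune]
  congr 1
  ext d
  rw [mem_leftPart, Finset.mem_erase, mem_leftPart]
  exact and_iff_right (inlE_ne_inrE _ _)

theorem rightPart_cut_inr (S : Finset (G.add H).E) (e : H.E) :
    rightPart ((G.add H).cut S (inrE G e)) = H.cut (rightPart S) e := by
  classical
  rw [cut, rightPart_prune, cut]
  congr 1
  ext d
  rw [mem_rightPart, Finset.mem_erase, Finset.mem_erase, mem_rightPart]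
  exact and_congr_left' (not_congr inrE_injective.eq_iff)

/-- A cut prunes the whole union, so the untouched summand stays the same because it was already
pruned. -/
theorem isOption_add_iff {p : Player} {S S' : Finset (G.add H).E}
    (hG : G.prune (leftPart S) = leftPart S) (hH : H.prune (rightPart S) = rightPart S) :
    (G.add H).IsOption p S S' ↔
      (G.IsOption p (leftPart S) (leftPart S') ∧ rightPart S' = rightPart S) ∨
        (H.IsOption p (rightPart S) (rightPart S') ∧ leftPart S' = leftPart S) := by
  constructor
  · rintro ⟨e, he, hc, rfl⟩
    induction e using addE_cases with
    | inl e =>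
      left
      rw [leftPart_cut_inl, rightPart_cut_inl, hH]
      exact ⟨⟨e, mem_leftPart.2 he, hc, rfl⟩, rfl⟩
    | inr e =>
      right
      rw [leftPart_cut_inr, rightPart_cut_inr, hG]
      exact ⟨⟨e, mem_rightPart.2 he, hc, rfl⟩, rfl⟩
  · rintro (⟨⟨e, he, hc, h⟩, h'⟩ | ⟨⟨e, he, hc, h⟩, h'⟩)
    · refine ⟨_, mem_leftPart.1 he, hc, eq_of_parts ?_ ?_⟩
      · rw [leftPart_cut_inl, h]
      · rw [rightPart_cut_inl, h', hH]
    · refine ⟨_, mem_rightPart.1 he, hc, eq_of_parts ?_ ?_⟩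
      · rw [leftPart_cut_inr, h', hG]
      · rw [rightPart_cut_inr, h]

theorem exists_parts (A : Finset G.E) (B : Finset H.E) :
    ∃ S : Finset (G.add H).E, leftPart S = A ∧ rightPart S = B :=
  ⟨A.disjSum B, Finset.toLeft_disjSum, Finset.toRight_disjSum⟩

/-- The description of a disjoint union by descriptions of its parts. -/
def AddRel (R : Finset G.E → Multiset (ℕ × SignType) → Prop)
    (R' : Finset H.E → Multiset (ℕ × SignType) → Prop)
    (S : Finset (G.add H).E) (P : Multiset (ℕ × SignType)) : Prop :=
  ∃ P₁ P₂, P = P₁ + P₂ ∧ R (leftPart S) P₁ ∧ R' (rightPart S) P₂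

variable {R : Finset G.E → Multiset (ℕ × SignType) → Prop}
  {R' : Finset H.E → Multiset (ℕ × SignType) → Prop}

/-- Common transfer argument for `cutStem` and `pluck`: the relation `M` records the effect of the
move on the other components and must be stable under adding further ones. -/
theorem IsFlowerSum.exists_option_add (hR : G.IsFlowerSum R) (hR' : H.IsFlowerSum R')
    {p : Player} {S : Finset (G.add H).E} {c : ℕ × SignType} {Q : Multiset (ℕ × SignType)}
    {M : Multiset (ℕ × SignType) → Multiset (ℕ × SignType) → Prop}
    (hM : ∀ {Q₁ Q₂ P}, M Q₁ P → M (Q₁ + Q₂) (P + Q₂))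
    (hS : AddRel R R' S (c ::ₘ Q))
    (h : ∀ {S Q}, R S (c ::ₘ Q) → ∃ S' P, G.IsOption p S S' ∧ R S' P ∧ M Q P)
    (h' : ∀ {S Q}, R' S (c ::ₘ Q) → ∃ S' P, H.IsOption p S S' ∧ R' S' P ∧ M Q P) :
    ∃ S' P, (G.add H).IsOption p S S' ∧ AddRel R R' S' P ∧ M Q P := by
  obtain ⟨P₁, P₂, hP, h1, h2⟩ := hS
  have hc : c ∈ P₁ + P₂ := hP ▸ Multiset.mem_cons_self _ _
  rcases Multiset.mem_add.1 hc with hc | hc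
  · obtain ⟨Q₁, rfl⟩ := Multiset.exists_cons_of_mem hc
    rw [Multiset.cons_add, Multiset.cons_inj_right] at hP
    obtain ⟨A, P, h3, h4, h5⟩ := h h1
    obtain ⟨S', h6, h7⟩ := exists_parts A (rightPart S)
    refine ⟨S', P + P₂, (isOption_add_iff (hR.prune_eq h1) (hR'.prune_eq h2)).2
      (Or.inl ⟨by rwa [h6], h7⟩), ⟨P, P₂, rfl, by rwa [h6], by rwa [h7]⟩, ?_⟩
    rw [hP]
    exact hM h5
  · obtain ⟨Q₁, rfl⟩ := Multiset.exists_cons_of_mem hc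
    rw [Multiset.add_cons, Multiset.cons_inj_right] at hP
    obtain ⟨A, P, h3, h4, h5⟩ := h' h2
    obtain ⟨S', h6, h7⟩ := exists_parts (leftPart S) A
    refine ⟨S', P₁ + P, (isOption_add_iff (hR.prune_eq h1) (hR'.prune_eq h2)).2
      (Or.inr ⟨by rwa [h7], h6⟩), ⟨P₁, P, rfl, by rwa [h6], by rwa [h7]⟩, ?_⟩
    rw [hP, add_comm, add_comm P₁]
    exact hM h5

theorem IsFlowerSum.add (hR : G.IsFlowerSum R) (hR' : H.IsFlowerSum R') :
    (G.add H).IsFlowerSum (AddRel R R') where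
  prune_eq := by
    rintro S P ⟨P₁, P₂, rfl, h1, h2⟩
    refine eq_of_parts ?_ ?_
    · rw [leftPart_prune, hR.prune_eq h1]
    · rw [rightPart_prune, hR'.prune_eq h2]
  pos := by
    rintro S P ⟨P₁, P₂, rfl, h1, h2⟩ c hc
    rcases Multiset.mem_add.1 hc with hc | hc
    · exact hR.pos h1 c hc
    · exact hR'.pos h2 c hc
  move := by
    rintro p S P S' ⟨P₁, P₂, rfl, h1, h2⟩ h
    rcases (isOption_add_iff (hR.prune_eq h1) (hR'.prune_eq h2)).1 h with ⟨h3, h4⟩ | ⟨h3, h4⟩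
    · obtain ⟨c, c', Q, rfl, h5, h6⟩ := hR.move h1 h3
      exact ⟨c, c', Q + P₂, Multiset.cons_add _ _ _, h5, c' ::ₘ Q, P₂,
        (Multiset.cons_add _ _ _).symm, h6, by rwa [h4]⟩
    · obtain ⟨c, c', Q, rfl, h5, h6⟩ := hR'.move h2 h3
      exact ⟨c, c', P₁ + Q, Multiset.add_cons _ _ _, h5, P₁, c' ::ₘ Q,
        (Multiset.add_cons _ _ _).symm, by rwa [h4], h6⟩
  cutStem := by
    intro S c Q p k hS hk
    obtain ⟨S', P, h1, h2, rfl⟩ := hR.exists_option_add hR' (p := p)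
      (M := fun Q P => P = (k, 0) ::ₘ Q) (by rintro Q₁ Q₂ _ rfl; rw [Multiset.cons_add]) hS
      (fun h => let ⟨S', h1, h2⟩ := hR.cutStem p k h hk; ⟨S', _, h1, h2, rfl⟩)
      (fun h => let ⟨S', h1, h2⟩ := hR'.cutStem p k h hk; ⟨S', _, h1, h2, rfl⟩)
    exact ⟨S', h1, h2⟩
  pluck := by
    intro p S b Q hS
    obtain ⟨S', P, h1, h2, h3⟩ := hR.exists_option_add hR' (p := p)
      (M := fun Q P => P = (b, 0) ::ₘ Q ∨ P = (b, p.sgn) ::ₘ Q)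
      (by
        rintro Q₁ Q₂ _ (rfl | rfl)
        · exact Or.inl (Multiset.cons_add _ _ _)
        · exact Or.inr (Multiset.cons_add _ _ _)) hS
      (fun h => by
        obtain ⟨S', h1, h2 | h2⟩ := hR.pluck h
        exacts [⟨S', _, h1, h2, Or.inl rfl⟩, ⟨S', _, h1, h2, Or.inr rfl⟩])
      (fun h => by
        obtain ⟨S', h1, h2 | h2⟩ := hR'.pluck h
        exacts [⟨S', _, h1, h2, Or.inl rfl⟩, ⟨S', _, h1, h2, Or.inr rfl⟩])
    rcases h3 with rfl | rfl
    exacts [⟨S', h1, Or.inl h2⟩, ⟨S', h1, Or.inr h2⟩]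

theorem addRel_prune_univ {P₁ P₂ : Multiset (ℕ × SignType)}
    (h : R (G.prune Finset.univ) P₁) (h' : R' (H.prune Finset.univ) P₂) :
    AddRel R R' ((G.add H).prune Finset.univ) (P₁ + P₂) := by
  refine ⟨P₁, P₂, rfl, ?_, ?_⟩
  · rw [leftPart_prune]
    convert h
    ext e
    exact iff_of_true (mem_leftPart.2 (Finset.mem_univ _)) (Finset.mem_univ _)
  · rw [rightPart_prune]
    convert h'
    ext e
    exact iff_of_true (mem_rightPart.2 (Finset.mem_univ _)) (Finset.mem_univ _)

end Add

theorem isFlowerSum_empty : empty.IsFlowerSum fun _ P => P = 0 where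
  prune_eq := by
    rintro S P -
    ext e
    exact e.elim
  pos := by
    rintro S P rfl c hc
    simp at hc
  move := by
    rintro p S P S' - ⟨e, -⟩
    exact e.elim
  cutStem := fun _ _ h => absurd h (Multiset.cons_ne_zero)
  pluck := fun h => absurd h (Multiset.cons_ne_zero)

/-- A picture with a description of its initial position as a sum of Generalized Flowers. -/
def HasFlowers (G : Hackenbush) (P : Multiset (ℕ × SignType)) : Prop :=
  ∃ R, G.IsFlowerSum R ∧ R (G.prune Finset.univ) P

theorem HasFlowers.add {G H : Hackenbush} {P Q : Multiset (ℕ × SignType)}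
    (hG : G.HasFlowers P) (hH : H.HasFlowers Q) : (G.add H).HasFlowers (P + Q) :=
  let ⟨_, h1, h2⟩ := hG
  let ⟨_, h3, h4⟩ := hH
  ⟨_, h1.add h3, addRel_prune_univ h2 h4⟩

theorem hasFlowers_empty : empty.HasFlowers 0 := ⟨_, isFlowerSum_empty, rfl⟩

end Hackenbush

namespace Hackenbush

/-! ### Blossoms -/

section Value

variable {B : Hackenbush} {T : Finset B.E} {x : ℚ}

theorem hasValue_iff : (B.gameFrom T).HasValue x ↔
    ∃ (xl : {e : B.E // e ∈ T ∧ B.colour e ≠ .red} → ℚ)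
      (xr : {e : B.E // e ∈ T ∧ B.colour e ≠ .blue} → ℚ),
      (∀ i, (B.gameFrom (B.cut T i.1)).HasValue (xl i)) ∧
      (∀ j, (B.gameFrom (B.cut T j.1)).HasValue (xr j)) ∧
      IsSimplestIn {y | (∀ i, xl i < y) ∧ ∀ j, y < xr j} x := by
  rw [gameFrom, CGame.HasValue]

/-- Zero has the least denominator and the least absolute value, so it is simplest wherever it is
allowed. -/
theorem isSimplestIn_eq_zero {s : Set ℚ} {x : ℚ} (h : IsSimplestIn s x) (h0 : (0 : ℚ) ∈ s) :
    x = 0 := by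
  rcases h.2.2 0 h0 ⟨0, rfl⟩ with h1 | ⟨-, h1⟩
  · have := x.den_pos
    rw [Rat.den_zero] at h1
    omega
  · simpa using h1

/-- Every move in a blossom changes its value against the player who makes it. -/
theorem exists_value_cut {p : Player} (h : (B.gameFrom T).HasValue x) {e : B.E} (he : e ∈ T)
    (hc : p.CanCut (B.colour e)) :
    ∃ y, (B.gameFrom (B.cut T e)).HasValue y ∧
      p.sgn * SignType.sign y ≤ p.sgn * SignType.sign x ∧ (x = 0 → SignType.sign y = -p.sgn) := by
  obtain ⟨xl, xr, hl, hr, hs⟩ := hasValue_iff.1 h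
  cases p
  · have hlt : xl ⟨e, he, hc⟩ < x := hs.2.1.1 _
    refine ⟨xl ⟨e, he, hc⟩, hl ⟨e, he, hc⟩, ?_, ?_⟩
    · simpa [Player.sgn] using SignType.sign.monotone hlt.le
    · rintro rfl
      rw [sign_neg hlt]; rfl
  · have hlt : x < xr ⟨e, he, hc⟩ := hs.2.1.2 _
    refine ⟨xr ⟨e, he, hc⟩, hr ⟨e, he, hc⟩, ?_, ?_⟩
    · have key : ∀ s t : SignType, s ≤ t → -1 * t ≤ -1 * s := by decide
      exact key _ _ (SignType.sign.monotone hlt.le)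
    · rintro rfl
      rw [sign_pos hlt]; rfl

/-- A player can move in a blossom that favours her without making it favour her opponent. -/
theorem exists_good_cut {p : Player} (h : (B.gameFrom T).HasValue x)
    (hx : SignType.sign x = p.sgn) :
    ∃ e ∈ T, p.CanCut (B.colour e) ∧ ∃ y, (B.gameFrom (B.cut T e)).HasValue y ∧
      (SignType.sign y = 0 ∨ SignType.sign y = p.sgn) := by
  obtain ⟨xl, xr, hl, hr, hs⟩ := hasValue_iff.1 h
  cases p
  · have hpos : 0 < x := sign_eq_one_iff.1 hx
    -- If all left options were negative, 0 would be admissible, since the right options exceed x >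
    -- 0; then x would be 0.
    obtain ⟨⟨e, he, hc⟩, hi⟩ : ∃ i, 0 ≤ xl i := by
      by_contra! hneg
      exact hpos.ne' (isSimplestIn_eq_zero hs ⟨hneg, fun j => hpos.trans (hs.2.1.2 j)⟩)
    refine ⟨e, he, hc, _, hl ⟨e, he, hc⟩, ?_⟩
    rcases hi.eq_or_lt with h0 | h0
    · left; rw [← h0, sign_zero]
    · right; rw [sign_pos h0]; rfl
  · have hneg : x < 0 := sign_eq_neg_one_iff.1 hx
    obtain ⟨⟨e, he, hc⟩, hj⟩ : ∃ j, xr j ≤ 0 := by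
      by_contra! hpos
      exact hneg.ne (isSimplestIn_eq_zero hs ⟨fun i => (hs.2.1.1 i).trans hneg, hpos⟩)
    refine ⟨e, he, hc, _, hr ⟨e, he, hc⟩, ?_⟩
    rcases hj.eq_or_lt with h0 | h0
    · left; rw [h0, sign_zero]
    · right; rw [sign_neg h0]; rfl

end Value

/-! ### Generalized Flowers -/

section Stem

variable {h : ℕ} {B : Hackenbush}

/-- The edges of the stem. -/
def stemE (B : Hackenbush) (i : Fin h) : (onStem h B).E := (Sum.inl i : Fin h ⊕ B.E)

/-- The edges of the blossom. -/
def blossomE (h : ℕ) (e : B.E) : (onStem h B).E := (Sum.inr e : Fin h ⊕ B.E)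

/-- The vertices of the stem. -/
def stemV (B : Hackenbush) (j : Fin (h + 1)) : (onStem h B).V := (Sum.inl j : Fin (h + 1) ⊕ B.V)

/-- The places of the vertices of the blossom. -/
noncomputable def placeV (h : ℕ) (v : B.V) : (onStem h B).V := B.attach h v

theorem stemE_injective : Function.Injective (stemE B : Fin h → (onStem h B).E) :=
  Sum.inl_injective

theorem blossomE_injective : Function.Injective (blossomE h : B.E → (onStem h B).E) :=
  Sum.inr_injective

theorem stemE_ne_blossomE (i : Fin h) (e : B.E) : stemE B i ≠ blossomE h e := Sum.inl_ne_inr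

theorem stemE_cases {motive : (onStem h B).E → Prop} (stem : ∀ i, motive (stemE B i))
    (blossom : ∀ e, motive (blossomE h e)) (e : (onStem h B).E) : motive e :=
  Sum.rec (motive := motive) stem blossom e

theorem ends_stemE (i : Fin h) :
    (onStem h B).ends (stemE B i) = s(stemV B i.castSucc, stemV B i.succ) := rfl

theorem ends_blossomE (e : B.E) :
    (onStem h B).ends (blossomE h e) = (B.ends e).map (placeV h) := rfl

/-- The edges of the blossom that belong to `S`. -/
def blossomPart (S : Finset (onStem h B).E) : Finset B.E :=
  Finset.toRight (α := Fin h) (β := B.E) S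

theorem mem_blossomPart {S : Finset (onStem h B).E} {e : B.E} :
    e ∈ blossomPart S ↔ blossomE h e ∈ S :=
  Finset.mem_toRight

/-- What it means for a place to be connected to the ground. -/
def StemReachable (S : Finset (onStem h B).E) : (onStem h B).V → Prop :=
  Sum.elim (fun j : Fin (h + 1) => ∀ i : Fin h, i.val < j.val → stemE B i ∈ S)
    (fun v : B.V => (∀ i, stemE B i ∈ S) ∧ B.Reachable (blossomPart S) v)

theorem stemReachable_stemV {S : Finset (onStem h B).E} {j : Fin (h + 1)} :
    StemReachable S (stemV B j) ↔ ∀ i : Fin h, i.val < j.val → stemE B i ∈ S := Iff.rfl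

/-- A ground vertex of the blossom is placed at the top of the stem, where reachability in the
blossom is automatic and only the stem condition remains. -/
theorem stemReachable_placeV {S : Finset (onStem h B).E} {v : B.V} :
    StemReachable S (placeV h v) ↔
      (∀ i, stemE B i ∈ S) ∧ B.Reachable (blossomPart S) v := by
  by_cases hv : v ∈ B.ground
  · have : placeV h v = stemV B (Fin.last h) := if_pos hv
    rw [this, stemReachable_stemV]
    simp only [Fin.val_last, Fin.is_lt, forall_const]
    exact (and_iff_left (Reachable.ground v hv)).symm
  · have : placeV h v = (Sum.inr v : Fin (h + 1) ⊕ B.V) := if_neg hv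
    rw [this]
    rfl

theorem Reachable.stemReachable {S : Finset (onStem h B).E} {v : (onStem h B).V}
    (hv : (onStem h B).Reachable S v) : StemReachable S v := by
  induction hv with
  | ground v hv =>
    obtain rfl : v = stemV B 0 := hv
    rw [stemReachable_stemV]
    intro i hi
    simp at hi
  | step v w e _ he hvw ih =>
    induction e using stemE_cases with
    | stem i =>
      rw [ends_stemE, Sym2.eq_iff] at hvw
      rcases hvw with ⟨rfl, rfl⟩ | ⟨rfl, rfl⟩
      · rw [stemReachable_stemV] at ih ⊢
        intro k hk
        rcases (Nat.lt_succ_iff.1 hk).lt_or_eq with hk | hk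
        · exact ih k hk
        · rwa [Fin.ext hk]
      · rw [stemReachable_stemV] at ih ⊢
        exact fun k hk => ih k (Nat.lt_succ_of_lt hk)
    | blossom e =>
      rw [ends_blossomE] at hvw
      revert hvw
      generalize hab : B.ends e = z
      induction z using Sym2.ind with | _ a b
      rw [Sym2.map_mk, Sym2.eq_iff]
      rintro (⟨rfl, rfl⟩ | ⟨rfl, rfl⟩)
      · rw [stemReachable_placeV] at ih ⊢
        exact ⟨ih.1, .step a b e ih.2 (mem_blossomPart.2 he) hab⟩
      · rw [stemReachable_placeV] at ih ⊢
        exact ⟨ih.1, .step b a e ih.2 (mem_blossomPart.2 he) (hab.trans Sym2.eq_swap)⟩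

theorem reachable_stemV {S : Finset (onStem h B).E} {j : Fin (h + 1)} :
    (onStem h B).Reachable S (stemV B j) ↔ ∀ i : Fin h, i.val < j.val → stemE B i ∈ S := by
  refine ⟨fun hj => hj.stemReachable, fun hj => ?_⟩
  induction j using Fin.induction with
  | zero => exact .ground _ rfl
  | succ j ih =>
    exact .step _ _ _ (ih fun i hi => hj i (Nat.lt_succ_of_lt hi)) (hj j (Nat.lt_succ_self _))
      (ends_stemE j)

theorem reachable_placeV {S : Finset (onStem h B).E} {v : B.V} :
    (onStem h B).Reachable S (placeV h v) ↔
      (∀ i, stemE B i ∈ S) ∧ B.Reachable (blossomPart S) v := by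
  refine ⟨fun hv => stemReachable_placeV.1 hv.stemReachable, ?_⟩
  rintro ⟨hS, hv⟩
  induction hv with
  | ground v hv =>
    have : placeV h v = stemV B (Fin.last h) := if_pos hv
    rw [this, reachable_stemV]
    exact fun i _ => hS i
  | step v w e _ he hvw ih =>
    exact .step _ _ _ ih (mem_blossomPart.1 he) (by rw [ends_blossomE, hvw, Sym2.map_mk])

theorem stemE_mem_prune {S : Finset (onStem h B).E} {i : Fin h} :
    stemE B i ∈ (onStem h B).prune S ↔ ∀ k ≤ i, stemE B k ∈ S := by
  rw [mem_prune, ends_stemE]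
  simp only [Sym2.mem_iff, exists_eq_or_imp, exists_eq_left, reachable_stemV, Fin.val_castSucc,
    Fin.val_succ]
  constructor
  · rintro ⟨hi, hlt⟩ k hk
    rcases hk.lt_or_eq with hk | rfl
    · rcases hlt with hlt | hlt
      · exact hlt k hk
      · exact hlt k (Nat.lt_succ_of_lt hk)
    · exact hi
  · exact fun hS => ⟨hS i le_rfl, Or.inl fun k hk => hS k (Fin.le_of_lt hk)⟩

theorem blossomE_mem_prune {S : Finset (onStem h B).E} {e : B.E} :
    blossomE h e ∈ (onStem h B).prune S ↔
      (∀ i, stemE B i ∈ S) ∧ e ∈ B.prune (blossomPart S) := by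
  rw [mem_prune, mem_prune, ends_blossomE, mem_blossomPart]
  simp only [Sym2.mem_map, exists_exists_and_eq_and, reachable_placeV]
  constructor
  · rintro ⟨h1, v, h2, h3, h4⟩
    exact ⟨h3, h1, v, h2, h4⟩
  · rintro ⟨h3, h1, v, h2, h4⟩
    exact ⟨h1, v, h2, h3, h4⟩

theorem blossomPart_prune {S : Finset (onStem h B).E} (hS : ∀ i, stemE B i ∈ S) :
    blossomPart ((onStem h B).prune S) = B.prune (blossomPart S) := by
  ext e
  rw [mem_blossomPart, blossomE_mem_prune, and_iff_right hS]

/-- The stem has been cut to the height `k`. -/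
def IsCutTo (S : Finset (onStem h B).E) (k : ℕ) : Prop :=
  k < h ∧ (∀ i : Fin h, stemE B i ∈ S ↔ i.val < k) ∧ ∀ e, blossomE h e ∉ S

/-- The stem is intact and no part of the blossom is disconnected. -/
def IsIntact (S : Finset (onStem h B).E) : Prop :=
  (∀ i, stemE B i ∈ S) ∧ B.prune (blossomPart S) = blossomPart S

theorem IsCutTo.prune_eq {S : Finset (onStem h B).E} {k : ℕ} (hS : IsCutTo S k) :
    (onStem h B).prune S = S := by
  ext e
  induction e using stemE_cases with
  | stem i =>
    simp only [stemE_mem_prune, hS.2.1]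
    exact ⟨fun hi => hi i le_rfl, fun hi j hj => lt_of_le_of_lt hj hi⟩
  | blossom e =>
    refine iff_of_false (fun he => hS.2.2 e (mem_prune.1 he).1) (hS.2.2 e)

theorem IsIntact.prune_eq {S : Finset (onStem h B).E} (hS : IsIntact S) :
    (onStem h B).prune S = S := by
  ext e
  induction e using stemE_cases with
  | stem i =>
    rw [stemE_mem_prune]
    exact iff_of_true (fun k _ => hS.1 k) (hS.1 i)
  | blossom e =>
    rw [blossomE_mem_prune, hS.2, mem_blossomPart, and_iff_right hS.1]

/-- Only the edges up to `i` are assumed present, so this serves both intact and already truncated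
stems. -/
theorem isCutTo_cut {S : Finset (onStem h B).E} {i : Fin h}
    (hS : ∀ k ≤ i, stemE B k ∈ S) : IsCutTo ((onStem h B).cut S (stemE B i)) i := by
  classical
  refine ⟨i.2, fun j => ?_, fun e he => ?_⟩
  · rw [cut, stemE_mem_prune]
    simp only [Finset.mem_erase, ne_eq, stemE_injective.eq_iff]
    constructor
    · intro hj
      by_contra hlt
      exact (hj i (not_lt.1 hlt)).1 rfl
    · intro hj k hk
      have hki : k < i := lt_of_le_of_lt hk hj
      exact ⟨hki.ne, hS k hki.le⟩
  · rw [cut, blossomE_mem_prune] at he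
    simpa using he.1 i

theorem stemE_mem_cut_blossomE {S : Finset (onStem h B).E} (hS : ∀ i, stemE B i ∈ S) (e : B.E)
    (i : Fin h) : stemE B i ∈ (onStem h B).cut S (blossomE h e) := by
  classical
  rw [cut, stemE_mem_prune]
  exact fun k _ => Finset.mem_erase.2 ⟨stemE_ne_blossomE k e, hS k⟩

theorem blossomPart_cut {S : Finset (onStem h B).E} (hS : ∀ i, stemE B i ∈ S) (e : B.E) :
    blossomPart ((onStem h B).cut S (blossomE h e)) = B.cut (blossomPart S) e := by
  classical
  rw [cut, blossomPart_prune
    (fun k => Finset.mem_erase.2 ⟨stemE_ne_blossomE k e, hS k⟩), cut]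
  congr 1
  ext d
  rw [mem_blossomPart, Finset.mem_erase, Finset.mem_erase, mem_blossomPart]
  exact and_congr_left' (not_congr blossomE_injective.eq_iff)

theorem isIntact_cut {S : Finset (onStem h B).E} (hS : ∀ i, stemE B i ∈ S) (e : B.E) :
    IsIntact ((onStem h B).cut S (blossomE h e)) :=
  ⟨stemE_mem_cut_blossomE hS e, by rw [blossomPart_cut hS, prune_cut]⟩

/-- The description of the positions of a Generalized Flower. -/
def StemRel (S : Finset (onStem h B).E) (P : Multiset (ℕ × SignType)) : Prop :=
  (∃ k, IsCutTo S k ∧ P = {(k, 0)}) ∨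
    (IsIntact S ∧ ∃ x, (B.gameFrom (blossomPart S)).HasValue x ∧ P = {(h, SignType.sign x)})

/-- Cutting a stem edge discards the whole blossom and leaves a stalk; cutting a blossom edge keeps
the stem and acts on the blossom value as in `exists_value_cut` and `exists_good_cut`. -/
theorem isFlowerSum_onStem (hh : 0 < h) : (onStem h B).IsFlowerSum StemRel where
  prune_eq := by
    rintro S P (⟨k, hS, -⟩ | ⟨hS, -⟩)
    exacts [hS.prune_eq, hS.prune_eq]
  pos := by
    rintro S P (⟨k, hS, rfl⟩ | ⟨hS, x, -, rfl⟩) c hc h0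
    · rw [Multiset.mem_singleton.1 hc] at h0
      exact absurd rfl h0
    · rwa [Multiset.mem_singleton.1 hc]
  move := by
    rintro p S P _ (⟨k, hS, rfl⟩ | ⟨hS, x, hx, rfl⟩) ⟨e, he, hc, rfl⟩
    · induction e using stemE_cases with
      | stem i =>
        have hik := (hS.2.1 i).1 he
        exact ⟨(k, 0), (i, 0), 0, rfl, Or.inl ⟨hik, rfl⟩, Or.inl ⟨i, isCutTo_cut
          fun j hj => (hS.2.1 j).2 (lt_of_le_of_lt hj hik), rfl⟩⟩
      | blossom e => exact absurd he (hS.2.2 e)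
    · induction e using stemE_cases with
      | stem i =>
        exact ⟨(h, _), (i, 0), 0, rfl, Or.inl ⟨i.2, rfl⟩, Or.inl ⟨i, isCutTo_cut
          fun j _ => hS.1 j, rfl⟩⟩
      | blossom e =>
        obtain ⟨y, hy, h1, h2⟩ := exists_value_cut hx (mem_blossomPart.2 he) hc
        exact ⟨(h, _), (h, SignType.sign y), 0, rfl,
          Or.inr ⟨rfl, hh, h1, fun h0 => h2 (sign_eq_zero_iff.1 h0)⟩,
          Or.inr ⟨isIntact_cut hS.1 e, y, by rwa [blossomPart_cut hS.1], rfl⟩⟩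
  cutStem := by
    rintro S c Q p k (⟨m, hS, hP⟩ | ⟨hS, x, hx, hP⟩) hk
    · obtain ⟨rfl, rfl⟩ := (Multiset.singleton_eq_cons_iff _).1 hP.symm
      have hm := hS.1
      exact ⟨_, ⟨stemE B ⟨k, hk.trans hm⟩, (hS.2.1 _).2 hk, p.canCut_green, rfl⟩,
        Or.inl ⟨k, isCutTo_cut fun j hj => (hS.2.1 j).2 (lt_of_le_of_lt hj hk), rfl⟩⟩
    · obtain ⟨rfl, rfl⟩ := (Multiset.singleton_eq_cons_iff _).1 hP.symm
      exact ⟨_, ⟨stemE B ⟨k, hk⟩, hS.1 _, p.canCut_green, rfl⟩,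
        Or.inl ⟨k, isCutTo_cut fun j _ => hS.1 j, rfl⟩⟩
  pluck := by
    rintro p S b Q (⟨m, hS, hP⟩ | ⟨hS, x, hx, hP⟩)
    · obtain ⟨h1, -⟩ := (Multiset.singleton_eq_cons_iff _).1 hP.symm
      exact absurd (congrArg Prod.snd h1) p.sgn_ne_zero.symm
    · obtain ⟨h1, rfl⟩ := (Multiset.singleton_eq_cons_iff _).1 hP.symm
      obtain ⟨rfl, h2⟩ := Prod.mk.inj h1
      obtain ⟨e, he, hc, y, hy, h3⟩ := exists_good_cut hx h2
      have h4 := isIntact_cut hS.1 e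
      rw [← blossomPart_cut hS.1] at hy
      refine ⟨_, ⟨blossomE _ e, mem_blossomPart.1 he, hc, rfl⟩, ?_⟩
      rcases h3 with h3 | h3
      · exact Or.inl (Or.inr ⟨h4, y, hy, by rw [h3]; rfl⟩)
      · exact Or.inr (Or.inr ⟨h4, y, hy, by rw [h3]; rfl⟩)

theorem hasFlowers_onStem (hh : 0 < h) {x : ℚ} (hx : B.game.HasValue x) :
    (onStem h B).HasFlowers {(h, SignType.sign x)} := by
  have hstem : ∀ i, stemE B i ∈ (Finset.univ : Finset (onStem h B).E) :=
    fun i => Finset.mem_univ _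
  have hpart : blossomPart ((onStem h B).prune Finset.univ) = B.prune Finset.univ := by
    rw [blossomPart_prune hstem]
    congr 1
    ext e
    exact iff_of_true (mem_blossomPart.2 (Finset.mem_univ _)) (Finset.mem_univ _)
  refine ⟨StemRel, isFlowerSum_onStem hh, Or.inr ⟨⟨fun i => ?_, ?_⟩, x, ?_, rfl⟩⟩
  · exact stemE_mem_prune.2 fun k _ => hstem k
  · rw [hpart, prune_prune]
  · rwa [hpart]

end Stem

end Hackenbush

/-! ### Initial positions and the outcome of the sum. -/

namespace GeneralizedFlower

theorem hasFlowers_picture (F : GeneralizedFlower) {x : ℚ} (hx : F.blossom.game.HasValue x) :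
    F.picture.HasFlowers {(F.height, SignType.sign x)} :=
  Hackenbush.hasFlowers_onStem F.height_pos hx

theorem hasFlowers_stalks {A : List GeneralizedFlower} (hA : ∀ S ∈ A, S.IsStalk) :
    (Hackenbush.sum (A.map picture)).HasFlowers
      ((A.map fun S => (S.height, (0 : SignType)) : List (ℕ × SignType)) :
        Multiset (ℕ × SignType)) := by
  induction A with
  | nil => exact Hackenbush.hasFlowers_empty
  | cons S A ih =>
    have h1 := S.hasFlowers_picture (hA S List.mem_cons_self)
    rw [sign_zero] at h1
    exact h1.add (ih fun T hT => hA T (List.mem_cons_of_mem S hT))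

end GeneralizedFlower

theorem Hackenbush.outcome_eq {G : Hackenbush} {κ : Convention}
    (h : G.Wins κ .left (G.prune Finset.univ)) :
    (G.Wins κ .right (G.prune Finset.univ) → G.game.outcome κ = .N) ∧
      (¬ G.Wins κ .right (G.prune Finset.univ) → G.game.outcome κ = .L) :=
  ⟨fun h' => (if_pos h).trans (if_pos h'), fun h' => (if_pos h).trans (if_neg h')⟩

theorem proposition4p7 (F₁ F₂ : GeneralizedFlower) (A : List GeneralizedFlower)
    (hblue : F₁.IsBlue) (hred : F₂.IsRed) (hA : ∀ S ∈ A, S.IsStalk)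
    (hlt : F₁.height < F₂.height) :
    let F : CGame :=
      ((F₁.picture.add F₂.picture).add
        (Hackenbush.sum (A.map GeneralizedFlower.picture))).game
    let a : ℕ := nimSum (A.map GeneralizedFlower.height)
    F.outcome .normal = F.outcome .misere ∧
      (F₂.height ≤ upperNimSum a (F₁.height - 1) → F.outcome .normal = .N) ∧
      (upperNimSum a (F₁.height - 1) < F₂.height → F.outcome .normal = .L) := by
  intro F a
  obtain ⟨x, hx, hx0⟩ := hblue
  obtain ⟨y, hy, hy0⟩ := hred
  have h₁ := F₁.hasFlowers_picture hx
  have h₂ := F₂.hasFlowers_picture hy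
  rw [sign_pos hx0] at h₁
  rw [sign_neg hy0] at h₂
  obtain ⟨R, hR, hS⟩ := (h₁.add h₂).add (GeneralizedFlower.hasFlowers_stalks hA)
  set Q : Multiset (ℕ × SignType) :=
    ((A.map fun S => (S.height, (0 : SignType)) : List (ℕ × SignType)) :
      Multiset (ℕ × SignType)) with hQ
  have hQ0 : ∀ c ∈ Q, c.2 = 0 := by
    intro c hc
    rw [hQ, Multiset.mem_coe, List.mem_map] at hc
    obtain ⟨S, -, rfl⟩ := hc
    rfl
  have hQa : xorSum (Q.map Prod.fst) = a := by
    rw [hQ, Multiset.map_coe, List.map_map]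
    rfl
  have hpos := F₁.height_pos
  -- The sum of two singletons and `Q` is definitionally this double cons.
  replace hS : R _ ((F₁.height, Player.left.sgn) ::ₘ (F₂.height, -Player.left.sgn) ::ₘ Q) := hS
  have hleft := fun κ => hR.wins_of_lt (κ := κ) hS hQ0 hlt
  -- The bound 2 ≤ c needed here comes from 1 ≤ b < c.
  have hright := fun κ => (hR.opp_wins_iff (κ := κ) hS hQ0 hlt).trans
    (le_upperNimSum_iff (κ := κ) hpos (by omega)).symm
  rw [hQa] at hright
  have hN := fun κ hle => (Hackenbush.outcome_eq (hleft κ)).1 ((hright κ).2 hle)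
  have hL := fun κ (hle : ¬ F₂.height ≤ upperNimSum a (F₁.height - 1)) =>
    (Hackenbush.outcome_eq (hleft κ)).2 fun hw => hle ((hright κ).1 hw)
  refine ⟨?_, hN .normal, fun h => hL .normal (not_le.2 h)⟩
  by_cases hle : F₂.height ≤ upperNimSum a (F₁.height - 1)
  · exact (hN .normal hle).trans (hN .misere hle).symm
  · exact (hL .normal hle).trans (hL .misere hle).symm
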